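/- **Part 1.** Let $N\in\mathbb N$, let $H=(h_{m,n})_{m,n=1}^N$ be an $N\times N$ Hermitian matrix with Frobenius norm $\bigl(\sum_{m,n}|h_{m,n}|^2\bigr)^{1/2}<1$, let $\rho_m>0$, $\theta_m\in\mathbb R$ ($1\le m\le N$) and $W=(\rho_1e^{i\theta_1},\dots,\rho_Ne^{i\theta_N})^T$. Then $$\det(I_N+H)^{-1}\exp\bigl(W^*H(I_N+H)^{-1}W\bigr)=\sum_{K}\prod_{m=1}^N\Bigl[\Bigl(\prod_{n=1}^N(-h_{m,n})^{k_{m,n}}\Bigr)\binom{c_m}{k_{1,m},\dots,k_{N,m}}\bigl(\rho_me^{-i\theta_m}\bigr)^{r_m-c_m}L_{c_m}^{(r_m-c_m)}(\rho_m^2)\Bigr],$$ where the sum converges absolutely and runs over all $N\times N$ matrices $K=(k_{m,n})$ of nonnegative integers, $r_m=\sum_{\ell}k_{m,\ell}$ and $c_m=\sum_jk_{j,m}$ are the $m$-th row and column sums of $K$, and $L_n^{(\alpha)}(x)=\sum_{k=0}^n(-1)^k\binom{n+\alpha}{n-k}\frac{x^k}{k!}$ are the Laguerre polynomials. **Part 2.**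 Let $x,y>0$ be real and let $u,v\in\mathbb C$ with $|uv|<xy$. Then, with absolute convergence, $$\sum_{0\le j<k<\infty}\frac{u^jv^k+u^kv^j}{j!\,k!}\,C_j(k;x)\,C_j(k;y)=\frac{xy}{xy-uv}\exp\Bigl(-\frac{xuv-xy(u+v)+yuv}{xy-uv}\Bigr)-\frac{xy}{xy-uv}\exp\Bigl(-\frac{uv(x+y)}{xy-uv}\Bigr)I_0\Bigl(\frac{2xy\sqrt{uv}}{xy-uv}\Bigr),$$ where $C_n(x;a)=\sum_{k=0}^n\frac{(-n)_k(-x)_k}{k!}\bigl(-\frac1a\bigr)^k$, with $(t)_k=t(t+1)\cdots(t+k-1)$, are the Charlier polynomials, $I_0(z)=\sum_{m\ge0}\frac{(z/2)^{2m}}{(m!)^2}$ is the modified Bessel function of the first kind, and $\sqrt{uv}$ is either square root of $uv$. -/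

import Mathlib

open scoped Matrix

noncomputable section

/-- The Frobenius norm `(∑ |h_{m,n}|²)^{1/2}` of a complex square matrix. -/
def frobNorm {N : ℕ} (H : Matrix (Fin N) (Fin N) ℂ) : ℝ :=
  Real.sqrt (∑ m, ∑ n, ‖H m n‖ ^ 2)

/-- The sum of the entries of `K` in row `m`. -/
def rowSum {N : ℕ} (K : Matrix (Fin N) (Fin N) ℕ) (m : Fin N) : ℕ := ∑ l, K m l

/-- The sum of the entries of `K` in column `n`. -/
def colSum {N : ℕ} (K : Matrix (Fin N) (Fin N) ℕ) (n : Fin N) : ℕ := ∑ j, K j n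

/-- The Laguerre polynomial
`L_n^{(α)}(x) = ∑_{k=0}^n (-1)^k binom(n+α, n-k) x^k / k!`, for every real `α`
(`Ring.choose` is the generalised binomial coefficient `t(t-1)⋯(t-k+1)/k!`). -/
def laguerreL (n : ℕ) (α x : ℝ) : ℝ :=
  ∑ k ∈ Finset.range (n + 1),
    (-1) ^ k * Ring.choose ((n : ℝ) + α) (n - k) * x ^ k / (k.factorial : ℝ)

/-- The Charlier polynomial
`C_n(x; a) = ₂F₀(-n, -x; -; -1/a) = ∑_{k=0}^n (-n)_k (-x)_k / k! (-1/a)^k`,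
where `(t)_k = t(t+1)⋯(t+k-1)`. -/
def charlierC (n : ℕ) (x a : ℝ) : ℝ :=
  ∑ k ∈ Finset.range (n + 1),
    (ascPochhammer ℝ k).eval (-(n : ℝ)) * (ascPochhammer ℝ k).eval (-x)
      / (k.factorial : ℝ) * (-1 / a) ^ k

/-- The modified Bessel function of the first kind `I_ν(z)` of integer order `ν ≥ 0`:
`I_ν(z) = ∑_{m ≥ 0} (z/2)^{2m+ν} / (m! (m+ν)!)`. -/
def besselI (ν : ℕ) (z : ℂ) : ℂ :=
  ∑' m : ℕ, (z / 2) ^ (2 * m + ν) / ((m.factorial : ℂ) * ((m + ν).factorial : ℂ))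

end

/-! Both identities come from evaluating one Gaussian integral in two ways.

Part 1: integrate exp(∑ hₘₙ (w̄ₘ + i z̄ₘ)(wₙ + i zₙ)) against e^{-|z|²} over ℂᴺ. Expanding each of
the N² exponentials gives a series over matrices `K`. Its terms factor over coordinates into complex
Hermite polynomials, that is, Laguerre polynomials (`integral_monomial_eq_laguerre`). Alternatively,
a unitary change of variables diagonalises H and leaves N planar Gaussians
(`integral_gaussian_unitary_diagonal`). A Frobenius norm below 1 supplies the integrable majorant
for the interchange and keeps the eigenvalues above -1.

Part 2: C_j(k; a) is the symmetric sum ∑ C(j,m) C(k,m) m! τᵐ with τ = -1/a, itself a planar Gaussian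
integral of (1 + s z̄)ʲ (1 + s z)ᵏ with s² = τ. Summing under that integral gives the bilinear
generating function over all (j, k). Its diagonal, extracted by a circle average, is the Bessel
term; by symmetry, total minus diagonal is the sum over j < k.

`HasSum` over ℂ is unconditional, hence absolute, convergence. -/

/-! ### Gaussian integrals on the complex plane. -/

open MeasureTheory in
theorem integrable_exp_quadratic_norm (a c : ℝ) {b : ℝ} (hb : 0 < b) :
    Integrable (fun z : ℂ => Real.exp (a + c * ‖z‖ - b * ‖z‖ ^ 2)) := by
  have h0 : Integrable (fun z : ℂ => Real.exp (-(b / 2) * ‖z‖ ^ 2)) := by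
    have h := GaussianFourier.integrable_cexp_neg_mul_sq_norm_add (V := ℂ) (b := ((b / 2 : ℝ) : ℂ))
      (by simpa using hb) 0 0
    refine h.norm.congr (Filter.Eventually.of_forall fun z => ?_)
    simp only [Complex.norm_exp]
    congr 1
    simp [← Complex.ofReal_pow]
  refine (h0.const_mul (Real.exp (a + c ^ 2 / (2 * b)))).mono'
    (by fun_prop) (Filter.Eventually.of_forall fun z => ?_)
  rw [Real.norm_of_nonneg (Real.exp_nonneg _), ← Real.exp_add]
  refine Real.exp_le_exp.mpr ?_
  -- Half of the Gaussian decay absorbs the linear term by completing the square.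
  have : 0 ≤ (c - b * ‖z‖) ^ 2 / (2 * b) := by positivity
  have e : (c - b * ‖z‖) ^ 2 / (2 * b) = c ^ 2 / (2 * b) - c * ‖z‖ + b / 2 * ‖z‖ ^ 2 := by
    field_simp
    ring
  linarith

-- In real coordinates the linear coefficients are α + β and i(β - α), whose squares add up to 4αβ;
-- the two factors (π/b)^{1/2} multiply to π/b.
open MeasureTheory ComplexConjugate in
theorem integral_cexp_quadratic_complex {b : ℂ} (hb : 0 < b.re) (α β : ℂ) :
    ∫ z : ℂ, Complex.exp (-b * (‖z‖ : ℂ) ^ 2 + α * conj z + β * z)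
      = Real.pi / b * Complex.exp (α * β / b) := by
  have hb0 : b ≠ 0 := by rintro rfl; simp at hb
  have hre : (-b).re < 0 := by simpa using hb
  rw [← Complex.volume_preserving_equiv_real_prod.symm.integral_comp
    Complex.measurableEquivRealProd.symm.measurableEmbedding]
  have e : ∀ p : ℝ × ℝ, Complex.exp (-b * (‖Complex.measurableEquivRealProd.symm p‖ : ℂ) ^ 2
      + α * conj (Complex.measurableEquivRealProd.symm p)
      + β * Complex.measurableEquivRealProd.symm p)
      = Complex.exp (-b * (p.1 : ℂ) ^ 2 + (α + β) * p.1 + 0)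
        * Complex.exp (-b * (p.2 : ℂ) ^ 2 + (β - α) * Complex.I * p.2 + 0) := by
    intro p
    have h1 : Complex.measurableEquivRealProd.symm p = (p.1 : ℂ) + p.2 * Complex.I := by
      rw [Complex.measurableEquivRealProd_symm_apply, Complex.mk_eq_add_mul_I]
    rw [← Complex.exp_add, ← Complex.conj_mul', h1]
    congr 1
    simp only [map_add, map_mul, Complex.conj_ofReal, Complex.conj_I]
    linear_combination (b * p.2 ^ 2) * Complex.I_sq
  simp_rw [e]
  rw [show (volume : Measure (ℝ × ℝ)) = (volume : Measure ℝ).prod volume from rfl,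
    integral_prod_mul (fun p : ℝ => Complex.exp (-b * (p : ℂ) ^ 2 + (α + β) * p + 0))
      (fun p : ℝ => Complex.exp (-b * (p : ℂ) ^ 2 + (β - α) * Complex.I * p + 0)),
    integral_cexp_quadratic hre, integral_cexp_quadratic hre]
  have hpi : (Real.pi : ℂ) / - -b = Real.pi / b := by rw [neg_neg]
  have hpb : (Real.pi : ℂ) / b ≠ 0 := div_ne_zero (by exact_mod_cast Real.pi_ne_zero) hb0
  rw [hpi, mul_mul_mul_comm, ← Complex.cpow_add _ _ hpb, ← Complex.exp_add]
  rw [show (1 / 2 + 1 / 2 : ℂ) = 1 by norm_num, Complex.cpow_one]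
  congr 2
  field_simp
  linear_combination ((β-α)^2) * Complex.I_sq

theorem pow_le_factorial_mul_exp (n : ℕ) (x : ℝ) (hx : 0 ≤ x) :
    x ^ n ≤ n.factorial * Real.exp x := by
  have := Real.pow_div_factorial_le_exp x hx n
  rwa [div_le_iff₀' (by positivity)] at this

open MeasureTheory ComplexConjugate in
theorem integrable_gaussian_monomial (p q : ℕ) :
    Integrable (fun z : ℂ => conj z ^ p * z ^ q * (Real.exp (-‖z‖ ^ 2) : ℂ)) := by
  refine ((integrable_exp_quadratic_norm 0 1 one_pos).const_mul
    ((p + q).factorial : ℝ)).mono' ?_ (Filter.Eventually.of_forall fun z => ?_)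
  · refine Continuous.aestronglyMeasurable ?_
    fun_prop
  · rw [norm_mul, norm_mul, norm_pow, norm_pow, RCLike.norm_conj, ← pow_add, Complex.norm_real,
      Real.norm_of_nonneg (Real.exp_nonneg _),
      show 0 + 1 * ‖z‖ - 1 * ‖z‖ ^ 2 = ‖z‖ + -‖z‖ ^ 2 by ring, Real.exp_add, ← mul_assoc]
    gcongr
    exact pow_le_factorial_mul_exp _ _ (norm_nonneg z)

open MeasureTheory ComplexConjugate in
theorem integral_gaussian_monomial (p q : ℕ) :
    ∫ z : ℂ, conj z ^ p * z ^ q * (Real.exp (-‖z‖ ^ 2) : ℂ)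
      = if p = q then (Real.pi * p.factorial : ℂ) else 0 := by
  split_ifs with h
  · subst h
    have h1 := Complex.integral_rpow_mul_exp_neg_rpow (p := 2) (q := 2 * p) (by norm_num)
      (by have : (0:ℝ) ≤ p := p.cast_nonneg
          linarith)
    have h2 : ∀ z : ℂ, conj z ^ p * z ^ p * (Real.exp (-‖z‖ ^ 2) : ℂ)
        = ((‖z‖ ^ (2 * p : ℝ) * Real.exp (-‖z‖ ^ (2 : ℝ)) : ℝ) : ℂ) := by
      intro z
      rw [← mul_pow, Complex.conj_mul', show (2 * p : ℝ) = ((2 * p : ℕ) : ℝ) by push_cast; rfl,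
        Real.rpow_natCast, Real.rpow_two]
      push_cast
      rw [pow_mul]
    simp_rw [h2]
    rw [integral_complex_ofReal, h1, show ((2 * p + 2 : ℝ)) / 2 = p + 1 by ring,
      Real.Gamma_nat_eq_factorial]
    push_cast
    ring
  · set J := ∫ z : ℂ, conj z ^ p * z ^ q * (Real.exp (-‖z‖ ^ 2) : ℂ) with hJ
    have key : ∀ c : Circle, J = conj (c : ℂ) ^ p * (c : ℂ) ^ q * J := by
      intro c
      have h3 := (rotation c).measurePreserving.integral_comp
        (rotation c).toHomeomorph.measurableEmbedding
        (fun z : ℂ => conj z ^ p * z ^ q * (Real.exp (-‖z‖ ^ 2) : ℂ))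
      rw [← hJ] at h3
      refine h3.symm.trans ?_
      rw [hJ, ← integral_const_mul]
      congr 1
      ext z
      rw [rotation_apply, norm_mul, Circle.norm_coe, one_mul, map_mul]
      ring
    have h4 : ∃ c : Circle, conj (c : ℂ) ^ p * (c : ℂ) ^ q ≠ 1 := by
      -- Rotation by one radian: it fixes the integrand only if q - p is an integer multiple of 2π,
      -- impossible for p ≠ q as π is irrational.
      refine ⟨Circle.exp 1, fun h5 => h ?_⟩
      rw [Circle.coe_exp, ← Complex.exp_conj, ← Complex.exp_nat_mul, ← Complex.exp_nat_mul,
        ← Complex.exp_add, Complex.exp_eq_one_iff] at h5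
      obtain ⟨n, hn⟩ := h5
      have h6 := congrArg Complex.im hn
      simp at h6
      have h7 : ((q : ℤ) - p : ℤ) = n * (2 * Real.pi) := by push_cast; linarith
      by_contra hpq
      have hn0 : n ≠ 0 := by
        rintro rfl
        simp at h7
        apply hpq
        have : (q : ℝ) = p := by linarith
        exact_mod_cast this.symm
      refine irrational_pi.ne_rat (((q : ℤ) - p : ℤ) / (2 * n) : ℚ) ?_
      push_cast at h7 ⊢
      have : (n : ℝ) ≠ 0 := by exact_mod_cast hn0
      field_simp
      linarith
    obtain ⟨c, hc⟩ := h4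
    have h8 := key c
    have : (conj (c : ℂ) ^ p * (c : ℂ) ^ q - 1) * J = 0 := by linear_combination -h8
    rcases mul_eq_zero.mp this with h9 | h9
    · exact absurd (sub_eq_zero.mp h9) hc
    · exact h9

open MeasureTheory ComplexConjugate in
/-- Gaussian-integral representation of the complex Hermite polynomials. -/
theorem integral_gaussian_hermite (a b s t : ℂ) (p q : ℕ) :
    ∫ z : ℂ, (a + s * conj z) ^ p * (b + t * z) ^ q * (Real.exp (-‖z‖ ^ 2) : ℂ)
      = Real.pi * ∑ k ∈ Finset.range (q + 1),
          (p.choose k * q.choose k * k.factorial : ℂ) * (s * t) ^ k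
            * a ^ (p - k) * b ^ (q - k) := by
  have e : ∀ z : ℂ, (a + s * conj z) ^ p * (b + t * z) ^ q * (Real.exp (-‖z‖ ^ 2) : ℂ)
      = ∑ k ∈ Finset.range (q + 1), ∑ j ∈ Finset.range (p + 1),
        (s ^ j * a ^ (p - j) * p.choose j * (t ^ k * b ^ (q - k) * q.choose k))
          * (conj z ^ j * z ^ k * (Real.exp (-‖z‖ ^ 2) : ℂ)) := by
    intro z
    rw [add_comm a, add_comm b, add_pow, add_pow, Finset.sum_mul_sum, Finset.sum_mul,
      Finset.sum_comm]
    refine Finset.sum_congr rfl fun k _ => ?_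
    rw [Finset.sum_mul]
    refine Finset.sum_congr rfl fun j _ => ?_
    rw [mul_pow, mul_pow]
    ring
  simp_rw [e]
  rw [integral_finsetSum _ (fun k _ => integrable_finsetSum _ fun j _ =>
    (integrable_gaussian_monomial j k).const_mul _), Finset.mul_sum]
  refine Finset.sum_congr rfl fun k _ => ?_
  rw [integral_finsetSum _ (fun j _ => (integrable_gaussian_monomial j k).const_mul _)]
  simp_rw [integral_const_mul, integral_gaussian_monomial]
  simp only [mul_ite, mul_zero, Finset.sum_ite_eq', Finset.mem_range]
  split_ifs with h
  · rw [mul_pow]; ring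
  · rw [Nat.choose_eq_zero_of_lt (by omega)]
    simp

/-! ### Products of exponential series, and Laguerre polynomials in Hermite form. -/

theorem HasSum.mul_rclike {𝕜 ι κ : Type*} [RCLike 𝕜] {f : ι → 𝕜} {g : κ → 𝕜} {s t : 𝕜}
    (hf : HasSum f s) (hg : HasSum g t) : HasSum (fun p : ι × κ => f p.1 * g p.2) (s * t) := by
  have h1 : Summable fun i => ‖f i‖ := hf.summable.norm
  have h2 : Summable fun i => ‖g i‖ := hg.summable.norm
  have h3 := summable_mul_of_summable_norm h1 h2
  exact hf.mul hg h3

theorem hasSum_prod_pi {𝕜 κ : Type*} [RCLike 𝕜] {n : ℕ} (f : Fin n → κ → 𝕜) (s : Fin n → 𝕜)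
    (h : ∀ i, HasSum (f i) (s i)) : HasSum (fun k : Fin n → κ => ∏ i, f i (k i)) (∏ i, s i) := by
  induction n with
  | zero =>
    simp only [Finset.univ_eq_empty, Finset.prod_empty]
    exact hasSum_unique (fun _ : Fin 0 → κ => (1 : 𝕜))
  | succ n ih =>
    have h1 := ih (fun i : Fin n => f i.succ) (fun i => s i.succ) fun i => h i.succ
    have h2 := HasSum.mul_rclike (h 0) h1
    rw [Fin.prod_univ_succ, ← (Fin.consEquiv fun _ => κ).hasSum_iff]
    convert h2 using 1
    ext p
    simp [Fin.prod_univ_succ, Fin.consEquiv]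

theorem hasSum_prod_matrix_exp {𝕜 : Type*} [RCLike 𝕜] {N : ℕ} (z : Fin N → Fin N → 𝕜) :
    HasSum (fun K : Matrix (Fin N) (Fin N) ℕ => ∏ m, ∏ n, z m n ^ K m n / ((K m n).factorial : 𝕜))
      (∏ m, ∏ n, NormedSpace.exp (z m n)) :=
  hasSum_prod_pi (fun m (k : Fin N → ℕ) => ∏ n, z m n ^ k n / ((k n).factorial : 𝕜)) _ fun m =>
    hasSum_prod_pi (fun n (k : ℕ) => z m n ^ k / (k.factorial : 𝕜)) _ fun n =>
      NormedSpace.expSeries_div_hasSum_exp (z m n)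

/-- With α = r - c the upper binomial index c + α is the natural number r. Reversing the summation
then matches the two sums term by term, even when r < c. -/
theorem laguerreL_sub_eq_hermite (r c : ℕ) {x : ℝ} {w v : ℂ} (hv : v ≠ 0) (h : w * v = x) :
    (c.factorial : ℂ) * v ^ ((r : ℤ) - (c : ℤ)) * (laguerreL c ((r : ℝ) - (c : ℝ)) x : ℝ)
      = (-1) ^ c * ∑ k ∈ Finset.range (c + 1),
          (r.choose k * c.choose k * k.factorial : ℂ) * (-1) ^ k * v ^ (r - k) * w ^ (c - k) := by
  unfold laguerreL
  rw [← Finset.sum_flip, Complex.ofReal_sum, Finset.mul_sum, Finset.mul_sum]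
  refine Finset.sum_congr rfl fun k hk => ?_
  have hk : k ≤ c := Nat.lt_succ_iff.mp (Finset.mem_range.mp hk)
  rw [add_sub_cancel, Nat.sub_sub_self hk, Ring.choose_natCast]
  -- The truncated exponent r - k is faithful only for k ≤ r; beyond that the binomial coefficient
  -- kills both terms.
  by_cases hkr : k ≤ r
  · have h1 : v ^ ((r : ℤ) - (c : ℤ)) * v ^ (c - k) = v ^ (r - k) := by
      rw [← zpow_natCast, ← zpow_add₀ hv, ← zpow_natCast]
      congr 1
      omega
    have h2 : (c.choose k * k.factorial * (c - k).factorial : ℂ) = c.factorial := by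
      exact_mod_cast Nat.choose_mul_factorial_mul_factorial hk
    have h3 : (-1 : ℂ) ^ (c - k) = (-1) ^ c * (-1) ^ k := by
      obtain ⟨d, rfl⟩ := Nat.exists_eq_add_of_le hk
      rw [Nat.add_sub_cancel_left, pow_add, mul_right_comm, ← mul_pow]
      simp
    push_cast
    rw [← h, ← h1, ← h2, h3, mul_pow]
    have := Nat.factorial_ne_zero (c - k)
    field_simp
  · rw [Nat.choose_eq_zero_of_lt (not_le.mp hkr)]
    simp

/-! ### Unitary invariance and Frobenius norm bounds. -/

open MeasureTheory in
theorem integral_comp_unitary_mulVec {N : ℕ} {U : Matrix (Fin N) (Fin N) ℂ} (hU : Uᴴ * U = 1)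
    (f : (Fin N → ℂ) → ℂ) : ∫ z, f (U *ᵥ z) = ∫ z, f z := by
  have hU' : U * Uᴴ = 1 := mul_eq_one_comm.mp hU
  let e : (Fin N → ℂ) ≃ₗ[ℂ] (Fin N → ℂ) := Matrix.toLin'OfInv hU hU'
  let L : (Fin N → ℂ) ≃ₗ[ℝ] (Fin N → ℂ) := e.restrictScalars ℝ
  have hdet : |LinearMap.det (L : (Fin N → ℂ) →ₗ[ℝ] (Fin N → ℂ))| = 1 := by
    have h1 : (L : (Fin N → ℂ) →ₗ[ℝ] (Fin N → ℂ)) = (Matrix.toLin' U).restrictScalars ℝ := by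
      ext; rfl
    -- The real determinant of a complex-linear map is |det|², here 1.
    rw [h1, LinearMap.det_restrictScalars, LinearMap.det_toLin', Algebra.norm_complex_apply,
      Complex.normSq_eq_norm_sq]
    have h2 : ‖U.det‖ * ‖U.det‖ = 1 := by
      have := congrArg (fun M => ‖Matrix.det M‖) hU
      simpa [Matrix.det_mul, Matrix.det_conjTranspose] using this
    rw [sq, h2, abs_one]
  have h0 : LinearMap.det (L : (Fin N → ℂ) →ₗ[ℝ] (Fin N → ℂ)) ≠ 0 := by
    intro h; rw [h] at hdet; simp at hdet
  have hm := Measure.map_linearMap_addHaar_eq_smul_addHaar (volume : Measure (Fin N → ℂ)) h0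
  rw [abs_inv, hdet, inv_one, ENNReal.ofReal_one, one_smul] at hm
  have h3 := (L.toContinuousLinearEquiv.toHomeomorph.measurableEmbedding).integral_map
    (μ := volume) f
  have h4 : Measure.map (L.toContinuousLinearEquiv.toHomeomorph) volume
      = (volume : Measure (Fin N → ℂ)) := hm
  rw [h4] at h3
  exact h3.symm

/-- Cauchy–Schwarz over index pairs. It serves both the eigenvalue bound and the majorant for
termwise integration. -/
theorem sum_norm_mul_le_frobNorm {N : ℕ} (H : Matrix (Fin N) (Fin N) ℂ) (x : Fin N → ℝ) :
    ∑ m, ∑ n, ‖H m n‖ * (x m * x n) ≤ frobNorm H * ∑ m, x m ^ 2 := by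
  have h := Real.sum_mul_le_sqrt_mul_sqrt (Finset.univ : Finset (Fin N × Fin N))
    (fun p => ‖H p.1 p.2‖) (fun p => x p.1 * x p.2)
  simp only [Fintype.sum_prod_type] at h
  refine h.trans (le_of_eq ?_)
  unfold frobNorm
  congr 1
  simp_rw [mul_pow]
  rw [← Finset.sum_mul_sum, ← sq, Real.sqrt_sq (Finset.sum_nonneg fun _ _ => sq_nonneg _)]

theorem Matrix.IsHermitian.abs_eigenvalues_le_frobNorm {N : ℕ} {H : Matrix (Fin N) (Fin N) ℂ}
    (hH : H.IsHermitian) (i : Fin N) : |hH.eigenvalues i| ≤ frobNorm H := by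
  rw [hH.eigenvalues_eq]
  set x : Fin N → ℂ := (hH.eigenvectorBasis i).ofLp with hx
  have hn : ∑ m, ‖x m‖ ^ 2 = 1 := by
    rw [← EuclideanSpace.norm_sq_eq, hH.eigenvectorBasis.norm_eq_one, one_pow]
  refine (RCLike.abs_re_le_norm _).trans ?_
  calc ‖star x ⬝ᵥ H *ᵥ x‖ ≤ ∑ m, ∑ n, ‖H m n‖ * (‖x m‖ * ‖x n‖) := by
        simp only [dotProduct, Matrix.mulVec, Finset.mul_sum]
        refine (norm_sum_le _ _).trans (Finset.sum_le_sum fun m _ =>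
          (norm_sum_le _ _).trans (Finset.sum_le_sum fun n _ => le_of_eq ?_))
        simp only [norm_mul, Pi.star_apply, norm_star]
        ring
    _ ≤ frobNorm H * ∑ m, ‖x m‖ ^ 2 := sum_norm_mul_le_frobNorm H _
    _ = frobNorm H := by rw [hn, mul_one]

/-! ### The two evaluations of the N-dimensional integral. -/

-- The absolute values of the terms sum to an exponential bounded by exp(‖H‖ ∑ (|wₘ| + |zₘ|)²) with
-- ‖H‖ the Frobenius norm; against e^{-|z|²} this leaves the decay rate 1 - ‖H‖ > 0.
open MeasureTheory ComplexConjugate in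
theorem hasSum_integral_exp_sesquilinear {N : ℕ} (H : Matrix (Fin N) (Fin N) ℂ)
    (hF : frobNorm H < 1) (w : Fin N → ℂ) :
    HasSum (fun K : Matrix (Fin N) (Fin N) ℕ => ∫ z : Fin N → ℂ,
        (∏ m, ∏ n, (H m n * ((conj (w m) + Complex.I * conj (z m)) * (w n + Complex.I * z n)))
          ^ K m n / ((K m n).factorial : ℂ)) * ∏ m, (Real.exp (-‖z m‖ ^ 2) : ℂ))
      (∫ z : Fin N → ℂ,
        Complex.exp (∑ m, ∑ n, H m n * ((conj (w m) + Complex.I * conj (z m))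
          * (w n + Complex.I * z n))) * ∏ m, (Real.exp (-‖z m‖ ^ 2) : ℂ)) := by
  set Q : (Fin N → ℂ) → Fin N → Fin N → ℂ := fun z m n =>
    H m n * ((conj (w m) + Complex.I * conj (z m)) * (w n + Complex.I * z n)) with hQ
  have hexp : ∀ z : Fin N → ℂ, HasSum (fun K : Matrix (Fin N) (Fin N) ℕ =>
      ∏ m, ∏ n, Q z m n ^ K m n / ((K m n).factorial : ℂ))
      (Complex.exp (∑ m, ∑ n, Q z m n)) := by
    intro z
    have h := hasSum_prod_matrix_exp (Q z)
    simp_rw [Complex.exp_sum, Complex.exp_eq_exp_ℂ]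
    exact h
  have hnorm : ∀ z : Fin N → ℂ, HasSum (fun K : Matrix (Fin N) (Fin N) ℕ =>
      ‖(∏ m, ∏ n, Q z m n ^ K m n / ((K m n).factorial : ℂ))
        * ∏ m, (Real.exp (-‖z m‖ ^ 2) : ℂ)‖)
      (Real.exp (∑ m, ∑ n, ‖Q z m n‖) * ∏ m, Real.exp (-‖z m‖ ^ 2)) := by
    intro z
    have h := (hasSum_prod_matrix_exp (fun m n => ‖Q z m n‖)).mul_right
      (∏ m, Real.exp (-‖z m‖ ^ 2))
    simp_rw [Real.exp_sum]
    rw [← Real.exp_eq_exp_ℝ] at h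
    simp only [norm_mul, norm_prod, norm_div, norm_pow, Complex.norm_natCast, Complex.norm_real,
      Real.norm_of_nonneg (Real.exp_nonneg _)]
    exact h
  have : Countable (Matrix (Fin N) (Fin N) ℕ) := inferInstanceAs (Countable (Fin N → Fin N → ℕ))
  refine hasSum_integral_of_dominated_convergence
    (fun K z => ‖(∏ m, ∏ n, Q z m n ^ K m n / ((K m n).factorial : ℂ))
        * ∏ m, (Real.exp (-‖z m‖ ^ 2) : ℂ)‖) ?_ ?_ ?_ ?_ ?_
  · intro K
    refine Continuous.aestronglyMeasurable ?_
    fun_prop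
  · exact fun K => Filter.Eventually.of_forall fun z => le_rfl
  · exact Filter.Eventually.of_forall fun z => (hnorm z).summable
  · simp_rw [fun z => (hnorm z).tsum_eq]
    have hint : Integrable (fun z : Fin N → ℂ => ∏ m, Real.exp (frobNorm H * ‖w m‖ ^ 2
        + (2 * frobNorm H * ‖w m‖) * ‖z m‖ - (1 - frobNorm H) * ‖z m‖ ^ 2)) :=
      Integrable.fintype_prod (μ := fun _ => volume) (f := fun m (z : ℂ) =>
        Real.exp (frobNorm H * ‖w m‖ ^ 2 + (2 * frobNorm H * ‖w m‖) * ‖z‖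
          - (1 - frobNorm H) * ‖z‖ ^ 2)) fun m =>
        integrable_exp_quadratic_norm _ _ (by linarith)
    refine hint.mono' ?_ (Filter.Eventually.of_forall fun z => ?_)
    · refine Continuous.aestronglyMeasurable ?_
      simp only [hQ]
      fun_prop
    · rw [Real.norm_of_nonneg (by positivity), ← Real.exp_sum, ← Real.exp_sum, ← Real.exp_add]
      refine Real.exp_le_exp.mpr ?_
      have hF0 : 0 ≤ frobNorm H := Real.sqrt_nonneg _
      have h1 : ∑ m, ∑ n, ‖Q z m n‖
          ≤ frobNorm H * ∑ m, (‖w m‖ + ‖z m‖) ^ 2 := by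
        refine le_trans ?_ (sum_norm_mul_le_frobNorm H _)
        refine Finset.sum_le_sum fun m _ => Finset.sum_le_sum fun n _ => ?_
        simp only [hQ, norm_mul]
        gcongr
        · refine (norm_add_le _ _).trans ?_
          simp
        · refine (norm_add_le _ _).trans ?_
          simp
      refine (add_le_add_left h1 _).trans (le_of_eq ?_)
      rw [Finset.mul_sum, ← Finset.sum_add_distrib]
      refine Finset.sum_congr rfl fun m _ => ?_
      ring
  · exact Filter.Eventually.of_forall fun z => (hexp z).mul_right _

open MeasureTheory ComplexConjugate in
theorem integral_monomial_eq_laguerre {N : ℕ} (H : Matrix (Fin N) (Fin N) ℂ)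
    (w : Fin N → ℂ) (hw : ∀ m, w m ≠ 0) (K : Matrix (Fin N) (Fin N) ℕ) :
    ∫ z : Fin N → ℂ,
        (∏ m, ∏ n, (H m n * ((conj (w m) + Complex.I * conj (z m)) * (w n + Complex.I * z n)))
          ^ K m n / ((K m n).factorial : ℂ)) * ∏ m, (Real.exp (-‖z m‖ ^ 2) : ℂ)
      = Real.pi ^ N * ∏ m, ((∏ n, (-H m n) ^ K m n)
          * (Nat.multinomial Finset.univ (fun j => K j m) : ℂ)
          * conj (w m) ^ ((rowSum K m : ℤ) - (colSum K m : ℤ))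
          * (laguerreL (colSum K m) ((rowSum K m : ℝ) - (colSum K m : ℝ)) (‖w m‖ ^ 2) : ℝ)) := by
  have e : ∀ z : Fin N → ℂ,
      (∏ m, ∏ n, (H m n * ((conj (w m) + Complex.I * conj (z m)) * (w n + Complex.I * z n)))
          ^ K m n / ((K m n).factorial : ℂ)) * ∏ m, (Real.exp (-‖z m‖ ^ 2) : ℂ)
      = (∏ m, ∏ n, H m n ^ K m n / ((K m n).factorial : ℂ))
        * ∏ m, ((conj (w m) + Complex.I * conj (z m)) ^ rowSum K m
          * (w m + Complex.I * z m) ^ colSum K m * (Real.exp (-‖z m‖ ^ 2) : ℂ)) := by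
    intro z
    have h1 : ∀ m n, (H m n * ((conj (w m) + Complex.I * conj (z m)) * (w n + Complex.I * z n)))
          ^ K m n / ((K m n).factorial : ℂ)
        = (H m n ^ K m n / ((K m n).factorial : ℂ)) * ((conj (w m) + Complex.I * conj (z m)) ^ K m n
          * (w n + Complex.I * z n) ^ K m n) := by
      intro m n
      rw [mul_pow, mul_pow]
      ring
    simp_rw [h1, Finset.prod_mul_distrib]
    rw [Finset.prod_comm (f := fun m n => (w n + Complex.I * z n) ^ K m n)]
    simp_rw [Finset.prod_pow_eq_pow_sum]
    simp only [rowSum, colSum]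
    ring
  simp_rw [e]
  rw [integral_const_mul, integral_fintype_prod_volume_eq_prod (fun m (z : ℂ) =>
    (conj (w m) + Complex.I * conj z) ^ rowSum K m
          * (w m + Complex.I * z) ^ colSum K m * (Real.exp (-‖z‖ ^ 2) : ℂ))]
  simp_rw [integral_gaussian_hermite, Complex.I_mul_I]
  have h2 : ∀ m, (Nat.multinomial Finset.univ (fun j => K j m) : ℂ)
      = (colSum K m).factorial / ∏ j, ((K j m).factorial : ℂ) := by
    intro m
    have h3 := Nat.multinomial_spec Finset.univ (fun j => K j m)
    have h4 : (∏ j, ((K j m).factorial : ℂ)) ≠ 0 :=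
      Finset.prod_ne_zero_iff.mpr fun j _ => by exact_mod_cast Nat.factorial_ne_zero _
    rw [eq_div_iff h4, mul_comm]
    exact_mod_cast h3
  have h5 : ∀ m, (∏ n, (-H m n) ^ K m n)
          * (Nat.multinomial Finset.univ (fun j => K j m) : ℂ)
          * conj (w m) ^ ((rowSum K m : ℤ) - (colSum K m : ℤ))
          * (laguerreL (colSum K m) ((rowSum K m : ℝ) - (colSum K m : ℝ)) (‖w m‖ ^ 2) : ℝ)
      = ((∏ n, (-1) ^ K m n) * (-1) ^ colSum K m) * ((∏ n, H m n ^ K m n)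
          / ∏ j, ((K j m).factorial : ℂ))
        * ∑ k ∈ Finset.range (colSum K m + 1),
          ((rowSum K m).choose k * (colSum K m).choose k * k.factorial : ℂ) * (-1) ^ k
            * conj (w m) ^ (rowSum K m - k) * w m ^ (colSum K m - k) := by
    intro m
    have h6 := laguerreL_sub_eq_hermite (rowSum K m) (colSum K m) (x := ‖w m‖ ^ 2) (w := w m)
      (v := conj (w m)) (by simpa using hw m) (by rw [Complex.mul_conj']; push_cast; rfl)
    have h7 : ∏ n, (-H m n) ^ K m n = (∏ n, (-1) ^ K m n) * ∏ n, H m n ^ K m n := by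
      rw [← Finset.prod_mul_distrib]
      exact Finset.prod_congr rfl fun n _ => by rw [neg_pow]
    rw [h2, h7]
    linear_combination ((∏ n, (-1) ^ K m n) * (∏ n, H m n ^ K m n)
          / ∏ j, ((K j m).factorial : ℂ)) * h6
  simp_rw [h5, Finset.prod_mul_distrib, Finset.prod_div_distrib]
  -- The signs of -H and those from the Hermite form both equal (-1) to the sum of all entries of
  -- `K`, so they cancel.
  have h8 : (∏ m, ∏ n, (-1 : ℂ) ^ K m n) * ∏ m, (-1 : ℂ) ^ colSum K m = 1 := by
    rw [Finset.prod_comm]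
    simp_rw [Finset.prod_pow_eq_pow_sum]
    simp only [colSum]
    rw [← mul_pow]
    simp
  rw [h8, Finset.prod_comm (f := fun m n => ((K n m).factorial : ℂ)), Finset.prod_const,
    Finset.card_univ, Fintype.card_fin]
  ring

open MeasureTheory ComplexConjugate in
theorem integral_gaussian_one_dim {d : ℝ} (hd : -1 < d) (v : ℂ) :
    ∫ z : ℂ, Complex.exp (d * ((conj v + Complex.I * conj z) * (v + Complex.I * z)))
        * (Real.exp (-‖z‖ ^ 2) : ℂ)
      = Real.pi * ((1 + d : ℂ)⁻¹ * Complex.exp (conj v * (d / (1 + d) * v))) := by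
  have hd0 : (1 + d : ℂ) ≠ 0 := by
    have : (1 + d : ℝ) ≠ 0 := by linarith
    exact_mod_cast this
  have e : ∀ z : ℂ, Complex.exp (d * ((conj v + Complex.I * conj z) * (v + Complex.I * z)))
        * (Real.exp (-‖z‖ ^ 2) : ℂ)
      = Complex.exp (d * (conj v * v)) * Complex.exp (-(1 + d : ℂ) * (‖z‖ : ℂ) ^ 2
        + (d * Complex.I * v) * conj z + (d * Complex.I * conj v) * z) := by
    intro z
    rw [Complex.ofReal_exp, ← Complex.exp_add, ← Complex.exp_add]
    congr 1
    push_cast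
    rw [← Complex.conj_mul']
    linear_combination (d * conj z * z) * Complex.I_sq
  have h1 : d * (conj v * v) + d * Complex.I * v * (d * Complex.I * conj v) / (1 + d)
      = conj v * (d / (1 + d) * v) := by
    field_simp
    linear_combination (d ^ 2 * conj v * v) * Complex.I_sq
  simp_rw [e]
  rw [integral_const_mul, integral_cexp_quadratic_complex (by simp; linarith), ← h1,
    Complex.exp_add]
  ring

open MeasureTheory ComplexConjugate in
theorem integral_gaussian_unitary_diagonal {N : ℕ} {U : Matrix (Fin N) (Fin N) ℂ} (hU : Uᴴ * U = 1)
    (d : Fin N → ℝ) (hd : ∀ m, -1 < d m) {H : Matrix (Fin N) (Fin N) ℂ}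
    (hH : H = U * Matrix.diagonal (fun m => (d m : ℂ)) * Uᴴ) (w : Fin N → ℂ) :
    ∫ z : Fin N → ℂ, Complex.exp (∑ m, ∑ n, H m n * ((conj (w m) + Complex.I * conj (z m))
          * (w n + Complex.I * z n))) * ∏ m, (Real.exp (-‖z m‖ ^ 2) : ℂ)
      = Real.pi ^ N * ((1 + H).det⁻¹ * Complex.exp (star w ⬝ᵥ ((H * (1 + H)⁻¹) *ᵥ w))) := by
  have hU' : U * Uᴴ = 1 := mul_eq_one_comm.mp hU
  have hd0 : ∀ m, (1 + d m : ℂ) ≠ 0 := by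
    intro m
    have : (1 + d m : ℝ) ≠ 0 := by linarith [hd m]
    exact_mod_cast this
  set v : Fin N → ℂ := Uᴴ *ᵥ w with hv
  have hw : w = U *ᵥ v := by rw [hv, Matrix.mulVec_mulVec, hU', Matrix.one_mulVec]
  have hform : ∀ (g : Fin N → ℂ) (x y : Fin N → ℂ),
      star (U *ᵥ x) ⬝ᵥ ((U * Matrix.diagonal g * Uᴴ) *ᵥ (U *ᵥ y))
        = ∑ m, conj (x m) * (g m * y m) := by
    intro g x y
    rw [Matrix.mulVec_mulVec, Matrix.mul_assoc, hU, Matrix.mul_one, ← Matrix.mulVec_mulVec,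
      Matrix.star_mulVec, ← Matrix.dotProduct_mulVec, Matrix.mulVec_mulVec, hU, Matrix.one_mulVec]
    simp [dotProduct, Matrix.mulVec_diagonal]
  have h1 : (1 : Matrix (Fin N) (Fin N) ℂ) + H
      = U * Matrix.diagonal (fun m => (1 + d m : ℂ)) * Uᴴ := by
    rw [← Matrix.diagonal_add, Matrix.diagonal_one, Matrix.mul_add, Matrix.add_mul, Matrix.mul_one,
      hU', hH]
  have hinv : (1 + H)⁻¹ = U * Matrix.diagonal (fun m => (1 + d m : ℂ)⁻¹) * Uᴴ := by
    refine Matrix.inv_eq_right_inv ?_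
    rw [h1]
    calc _ = U * Matrix.diagonal (fun m => (1 + d m : ℂ)) * (Uᴴ * U)
          * Matrix.diagonal (fun m => (1 + d m : ℂ)⁻¹) * Uᴴ := by simp only [Matrix.mul_assoc]
      _ = 1 := by
        rw [hU, Matrix.mul_one, Matrix.mul_assoc U, Matrix.diagonal_mul_diagonal]
        simp [hd0, hU']
  have hHinv : H * (1 + H)⁻¹ = U * Matrix.diagonal (fun m => (d m / (1 + d m) : ℂ)) * Uᴴ := by
    rw [hinv, hH]
    calc _ = U * Matrix.diagonal (fun m => (d m : ℂ)) * (Uᴴ * U)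
          * Matrix.diagonal (fun m => (1 + d m : ℂ)⁻¹) * Uᴴ := by simp only [Matrix.mul_assoc]
      _ = _ := by
        rw [hU, Matrix.mul_one, Matrix.mul_assoc U, Matrix.diagonal_mul_diagonal]
        simp [div_eq_mul_inv]
  have hdet : (1 + H).det = ∏ m, (1 + d m : ℂ) := by
    rw [h1, Matrix.det_mul, Matrix.det_mul, mul_right_comm, ← Matrix.det_mul, hU', Matrix.det_one,
      one_mul, Matrix.det_diagonal]
  have hquad : ∀ z : Fin N → ℂ, ∑ m, ∑ n, H m n * ((conj (w m) + Complex.I * conj ((U *ᵥ z) m))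
          * (w n + Complex.I * (U *ᵥ z) n))
      = ∑ m, d m * ((conj (v m) + Complex.I * conj (z m)) * (v m + Complex.I * z m)) := by
    intro z
    -- Since w̄ + i z̄ is the conjugate of w - i z, the form is sesquilinear in two different
    -- vectors, w - i z and w + i z.
    have h2 := hform (fun m => (d m : ℂ)) (v - Complex.I • z) (v + Complex.I • z)
    rw [← hH, Matrix.mulVec_sub, Matrix.mulVec_add, Matrix.mulVec_smul, ← hw] at h2
    have h3 : ∑ m, ∑ n, H m n * ((conj (w m) + Complex.I * conj ((U *ᵥ z) m))
          * (w n + Complex.I * (U *ᵥ z) n))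
        = star (w - Complex.I • U *ᵥ z) ⬝ᵥ H *ᵥ (w + Complex.I • U *ᵥ z) := by
      simp only [dotProduct, Matrix.mulVec, Finset.mul_sum]
      refine Finset.sum_congr rfl fun m _ => Finset.sum_congr rfl fun n _ => ?_
      simp [dotProduct, Matrix.mulVec, Finset.mul_sum]
      ring
    rw [h3, h2]
    refine Finset.sum_congr rfl fun m _ => ?_
    simp
    ring
  have hgauss : ∀ z : Fin N → ℂ, ∏ m, (Real.exp (-‖(U *ᵥ z) m‖ ^ 2) : ℂ)
      = ∏ m, (Real.exp (-‖z m‖ ^ 2) : ℂ) := by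
    intro z
    have h4 : ∀ y : Fin N → ℂ, ∏ m, (Real.exp (-‖y m‖ ^ 2) : ℂ)
        = Complex.exp (-(star y ⬝ᵥ y)) := by
      intro y
      simp only [dotProduct, ← Finset.sum_neg_distrib, Complex.exp_sum]
      refine Finset.prod_congr rfl fun m _ => ?_
      rw [Pi.star_apply, Complex.star_def, Complex.conj_mul']
      push_cast
      rfl
    rw [h4, h4, Matrix.star_mulVec, ← Matrix.dotProduct_mulVec, Matrix.mulVec_mulVec, hU,
      Matrix.one_mulVec]
  rw [← integral_comp_unitary_mulVec hU]
  simp_rw [hquad, hgauss, Complex.exp_sum, ← Finset.prod_mul_distrib]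
  rw [integral_fintype_prod_volume_eq_prod (fun m (z : ℂ) =>
    Complex.exp (d m * ((conj (v m) + Complex.I * conj z) * (v m + Complex.I * z)))
      * (Real.exp (-‖z‖ ^ 2) : ℂ))]
  simp_rw [fun m => integral_gaussian_one_dim (hd m) (v m), Finset.prod_mul_distrib]
  rw [hdet, hHinv]
  conv_rhs => rw [hw, hform, Complex.exp_sum]
  simp [Finset.prod_inv_distrib]

open ComplexConjugate in
theorem hasSum_laguerre_matrix {N : ℕ} {H : Matrix (Fin N) (Fin N) ℂ} (hH : H.IsHermitian)
    (hF : frobNorm H < 1) (w : Fin N → ℂ) (hw : ∀ m, w m ≠ 0) :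
    HasSum (fun K : Matrix (Fin N) (Fin N) ℕ => ∏ m, ((∏ n, (-H m n) ^ K m n)
          * (Nat.multinomial Finset.univ (fun j => K j m) : ℂ)
          * conj (w m) ^ ((rowSum K m : ℤ) - (colSum K m : ℤ))
          * (laguerreL (colSum K m) ((rowSum K m : ℝ) - (colSum K m : ℝ)) (‖w m‖ ^ 2) : ℝ)))
      ((1 + H).det⁻¹ * Complex.exp (star w ⬝ᵥ ((H * (1 + H)⁻¹) *ᵥ w))) := by
  have h := hasSum_integral_exp_sesquilinear H hF w
  simp_rw [integral_monomial_eq_laguerre H w hw] at h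
  have hU : (hH.eigenvectorUnitary : Matrix (Fin N) (Fin N) ℂ)ᴴ * hH.eigenvectorUnitary = 1 :=
    Unitary.coe_star_mul_self hH.eigenvectorUnitary
  rw [integral_gaussian_unitary_diagonal hU hH.eigenvalues (fun m => by
    have := hH.abs_eigenvalues_le_frobNorm m
    linarith [neg_abs_le (hH.eigenvalues m)]) hH.spectral_theorem] at h
  have hpi : (Real.pi : ℂ) ^ N ≠ 0 := pow_ne_zero _ (by exact_mod_cast Real.pi_ne_zero)
  exact (hasSum_mul_left_iff hpi).mp h

/-! ### Charlier polynomials and their bilinear generating function. -/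

/-- The sum `∑ₘ C(j,m) C(k,m) m! τᵐ`, which is the Charlier polynomial for `τ = -1/a`. -/
def crossBinomialSum {R : Type*} [CommSemiring R] (j k : ℕ) (τ : R) : R :=
  ∑ m ∈ Finset.range (k + 1), (j.choose m * k.choose m * m.factorial : R) * τ ^ m

theorem crossBinomialSum_comm {R : Type*} [CommSemiring R] (j k : ℕ) (τ : R) :
    crossBinomialSum j k τ = crossBinomialSum k j τ := by
  have h : ∀ j k : ℕ, crossBinomialSum j k τ = ∑ m ∈ Finset.range (j + k + 1),
      (j.choose m * k.choose m * m.factorial : R) * τ ^ m := by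
    intro j k
    refine Finset.sum_subset (Finset.range_mono (by omega)) fun m _ hm => ?_
    rw [Finset.mem_range, not_lt] at hm
    rw [Nat.choose_eq_zero_of_lt (show k < m by omega)]
    simp
  rw [h, h, add_comm j k]
  exact Finset.sum_congr rfl fun m _ => by rw [mul_comm (j.choose m : R)]

theorem crossBinomialSum_zero {R : Type*} [CommSemiring R] (j k : ℕ) :
    crossBinomialSum j k (0 : R) = 1 := by
  unfold crossBinomialSum
  rw [Finset.sum_range_succ']
  simp

theorem norm_crossBinomialSum_le (j k : ℕ) (τ : ℂ) :
    ‖crossBinomialSum j k τ‖ ≤ crossBinomialSum j k ‖τ‖ := by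
  refine (norm_sum_le _ _).trans (le_of_eq (Finset.sum_congr rfl fun m _ => ?_))
  simp

theorem ofReal_crossBinomialSum (j k : ℕ) (τ : ℝ) :
    ((crossBinomialSum j k τ : ℝ) : ℂ) = crossBinomialSum j k (τ : ℂ) := by
  simp [crossBinomialSum]

theorem charlierC_natCast (j k : ℕ) (a : ℝ) :
    charlierC j k a = crossBinomialSum j k (-1 / a) := by
  -- `charlierC` truncates at its degree, `crossBinomialSum` at its second index, so the indices are
  -- swapped first.
  rw [crossBinomialSum_comm]
  unfold charlierC crossBinomialSum
  refine Finset.sum_congr rfl fun m _ => ?_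
  rw [ascPochhammer_eval_neg_eq_descPochhammer, ascPochhammer_eval_neg_eq_descPochhammer,
    descPochhammer_eval_eq_descFactorial, descPochhammer_eval_eq_descFactorial,
    Nat.descFactorial_eq_factorial_mul_choose, Nat.descFactorial_eq_factorial_mul_choose]
  have h1 : ((-1 : ℝ) ^ m) * (-1) ^ m = 1 := by rw [← mul_pow]; simp
  have h2 : (m.factorial : ℝ) ≠ 0 := by exact_mod_cast Nat.factorial_ne_zero m
  congr 1
  rw [div_eq_iff h2]
  push_cast
  linear_combination ((m.factorial : ℝ) * j.choose m * (m.factorial * k.choose m)) * h1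

open ComplexConjugate MeasureTheory in
theorem integral_gaussian_crossBinomialSum (s : ℂ) (j k : ℕ) :
    ∫ z : ℂ, (1 + s * conj z) ^ j * (1 + s * z) ^ k * (Real.exp (-‖z‖ ^ 2) : ℂ)
      = Real.pi * crossBinomialSum j k (s ^ 2) := by
  rw [integral_gaussian_hermite]
  simp [crossBinomialSum, sq]

open ComplexConjugate MeasureTheory in
theorem integral_gaussian_bilinear {u v s τ : ℂ} (h : ‖u * v * τ * s ^ 2‖ < 1) :
    ∫ z : ℂ, Complex.exp (u * (1 + s * conj z) + v * (1 + s * z)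
        + τ * (u * (1 + s * conj z)) * (v * (1 + s * z))) * (Real.exp (-‖z‖ ^ 2) : ℂ)
      = Real.pi * ((1 - u * v * τ * s ^ 2)⁻¹ * Complex.exp (u + v + τ * u * v
          + (u + τ * u * v) * (v + τ * u * v) * s ^ 2 / (1 - u * v * τ * s ^ 2))) := by
  set q := u * v * τ * s ^ 2 with hq
  have e : ∀ z : ℂ, Complex.exp (u * (1 + s * conj z) + v * (1 + s * z)
        + τ * (u * (1 + s * conj z)) * (v * (1 + s * z))) * (Real.exp (-‖z‖ ^ 2) : ℂ)
      = Complex.exp (u + v + τ * u * v) * Complex.exp (-(1 - q) * (‖z‖ : ℂ) ^ 2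
        + ((u + τ * u * v) * s) * conj z + ((v + τ * u * v) * s) * z) := by
    intro z
    rw [Complex.ofReal_exp, ← Complex.exp_add, ← Complex.exp_add]
    congr 1
    push_cast
    rw [← Complex.conj_mul', hq]
    ring
  have hb : 0 < (1 - q).re := by
    have := (Complex.re_le_norm q).trans_lt h
    simp only [Complex.sub_re, Complex.one_re]
    linarith
  simp_rw [e]
  rw [integral_const_mul, integral_cexp_quadratic_complex hb, Complex.exp_add _ (_ / _),
    show (u + τ * u * v) * s * ((v + τ * u * v) * s)
      = (u + τ * u * v) * (v + τ * u * v) * s ^ 2 by ring]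
  ring

-- Inserts a second factor into a known generating function: write it as a Gaussian integral,
-- replace u, v by u(1 + s z̄), v(1 + s z), and sum inside. The series for ‖τ‖ is needed because it
-- dominates the series for τ.
open ComplexConjugate MeasureTheory in
theorem hasSum_crossBinomialSum_mul_of_hasSum {u v s τ : ℂ}
    (hτ : ∀ A B : ℂ, HasSum (fun p : ℕ × ℕ => A ^ p.1 * B ^ p.2
      / ((p.1.factorial : ℂ) * (p.2.factorial : ℂ)) * crossBinomialSum p.1 p.2 τ)
      (Complex.exp (A + B + τ * A * B)))
    (hτ' : ∀ A B : ℂ, HasSum (fun p : ℕ × ℕ => A ^ p.1 * B ^ p.2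
      / ((p.1.factorial : ℂ) * (p.2.factorial : ℂ)) * crossBinomialSum p.1 p.2 (‖τ‖ : ℂ))
      (Complex.exp (A + B + ‖τ‖ * A * B)))
    (h : ‖u * v * τ * s ^ 2‖ < 1) :
    HasSum (fun p : ℕ × ℕ => u ^ p.1 * v ^ p.2
      / ((p.1.factorial : ℂ) * (p.2.factorial : ℂ)) * crossBinomialSum p.1 p.2 τ
        * crossBinomialSum p.1 p.2 (s ^ 2))
      ((1 - u * v * τ * s ^ 2)⁻¹ * Complex.exp (u + v + τ * u * v
          + (u + τ * u * v) * (v + τ * u * v) * s ^ 2 / (1 - u * v * τ * s ^ 2))) := by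
  have hreal : ∀ A B : ℝ, HasSum (fun p : ℕ × ℕ => A ^ p.1 * B ^ p.2
      / ((p.1.factorial : ℝ) * (p.2.factorial : ℝ)) * crossBinomialSum p.1 p.2 ‖τ‖)
      (Real.exp (A + B + ‖τ‖ * A * B)) := by
    intro A B
    have := hτ' A B
    simp_rw [← ofReal_crossBinomialSum] at this
    exact_mod_cast this
  have key := hasSum_integral_of_dominated_convergence (μ := (volume : Measure ℂ))
    (F := fun (p : ℕ × ℕ) (z : ℂ) => (u * (1 + s * conj z)) ^ p.1 * (v * (1 + s * z)) ^ p.2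
      / ((p.1.factorial : ℂ) * (p.2.factorial : ℂ)) * crossBinomialSum p.1 p.2 τ
      * (Real.exp (-‖z‖ ^ 2) : ℂ))
    (f := fun z : ℂ => Complex.exp (u * (1 + s * conj z) + v * (1 + s * z)
        + τ * (u * (1 + s * conj z)) * (v * (1 + s * z))) * (Real.exp (-‖z‖ ^ 2) : ℂ))
    (fun p z => ‖u * (1 + s * conj z)‖ ^ p.1 * ‖v * (1 + s * z)‖ ^ p.2
      / ((p.1.factorial : ℝ) * (p.2.factorial : ℝ)) * crossBinomialSum p.1 p.2 ‖τ‖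
      * Real.exp (-‖z‖ ^ 2)) ?_ ?_ ?_ ?_ ?_
  · rw [integral_gaussian_bilinear h] at key
    have e : ∀ (p : ℕ × ℕ) (z : ℂ), (u * (1 + s * conj z)) ^ p.1 * (v * (1 + s * z)) ^ p.2
      / ((p.1.factorial : ℂ) * (p.2.factorial : ℂ)) * crossBinomialSum p.1 p.2 τ
      * (Real.exp (-‖z‖ ^ 2) : ℂ) = (u ^ p.1 * v ^ p.2
      / ((p.1.factorial : ℂ) * (p.2.factorial : ℂ)) * crossBinomialSum p.1 p.2 τ)
        * ((1 + s * conj z) ^ p.1 * (1 + s * z) ^ p.2 * (Real.exp (-‖z‖ ^ 2) : ℂ)) := by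
      intro p z
      rw [mul_pow, mul_pow]
      ring
    simp_rw [e, integral_const_mul, integral_gaussian_crossBinomialSum,
      mul_left_comm _ (Real.pi : ℂ)] at key
    exact (hasSum_mul_left_iff (by exact_mod_cast Real.pi_ne_zero)).mp key
  · intro p
    refine Continuous.aestronglyMeasurable ?_
    fun_prop
  · refine fun p => Filter.Eventually.of_forall fun z => ?_
    rw [norm_mul, Complex.norm_real, Real.norm_of_nonneg (Real.exp_nonneg _), norm_mul, norm_div,
      norm_mul, norm_mul, norm_pow, norm_pow, Complex.norm_natCast, Complex.norm_natCast]
    gcongr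
    exact norm_crossBinomialSum_le _ _ _
  · exact Filter.Eventually.of_forall fun z => ((hreal _ _).mul_right _).summable
  · simp_rw [fun z : ℂ => ((hreal ‖u * (1 + s * conj z)‖ ‖v * (1 + s * z)‖).mul_right
      (Real.exp (-‖z‖ ^ 2))).tsum_eq]
    set c := ‖u‖ * ‖v‖ * ‖τ‖ with hc
    have hq : c * ‖s‖ ^ 2 < 1 := by simpa [hc] using h
    refine (integrable_exp_quadratic_norm (‖u‖ + ‖v‖ + c) ((‖u‖ + ‖v‖ + 2 * c) * ‖s‖)
      (b := 1 - c * ‖s‖ ^ 2) (by linarith)).mono' ?_ (Filter.Eventually.of_forall fun z => ?_)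
    · refine Continuous.aestronglyMeasurable ?_
      fun_prop
    · rw [Real.norm_of_nonneg (by positivity), ← Real.exp_add]
      refine Real.exp_le_exp.mpr ?_
      have h1 : ‖u * (1 + s * conj z)‖ ≤ ‖u‖ * (1 + ‖s‖ * ‖z‖) := by
        rw [norm_mul]
        gcongr
        refine (norm_add_le _ _).trans ?_
        simp
      have h2 : ‖v * (1 + s * z)‖ ≤ ‖v‖ * (1 + ‖s‖ * ‖z‖) := by
        rw [norm_mul]
        gcongr
        refine (norm_add_le _ _).trans ?_
        simp
      calc _ ≤ ‖u‖ * (1 + ‖s‖ * ‖z‖) + ‖v‖ * (1 + ‖s‖ * ‖z‖)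
            + ‖τ‖ * (‖u‖ * (1 + ‖s‖ * ‖z‖)) * (‖v‖ * (1 + ‖s‖ * ‖z‖)) + -‖z‖ ^ 2 := by gcongr
        _ = _ := by rw [hc]; ring
  · exact Filter.Eventually.of_forall fun z => (hτ _ _).mul_right _

/-- Bootstrap: for parameter 0 the sums are 1 and the series is a product of exponentials; inserting
a factor with s² = τ gives the general case. -/
theorem hasSum_crossBinomialSum (A B τ : ℂ) :
    HasSum (fun p : ℕ × ℕ => A ^ p.1 * B ^ p.2
      / ((p.1.factorial : ℂ) * (p.2.factorial : ℂ)) * crossBinomialSum p.1 p.2 τ)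
      (Complex.exp (A + B + τ * A * B)) := by
  obtain ⟨s, hs⟩ := IsAlgClosed.exists_pow_nat_eq τ two_pos
  have h0 : ∀ A B : ℂ, HasSum (fun p : ℕ × ℕ => A ^ p.1 * B ^ p.2
      / ((p.1.factorial : ℂ) * (p.2.factorial : ℂ)) * crossBinomialSum p.1 p.2 (0 : ℂ))
      (Complex.exp (A + B + 0 * A * B)) := by
    intro A B
    have hA := NormedSpace.expSeries_div_hasSum_exp A
    have hB := NormedSpace.expSeries_div_hasSum_exp B
    rw [← Complex.exp_eq_exp_ℂ] at hA hB
    have := hA.mul_rclike hB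
    rw [← Complex.exp_add] at this
    simpa [crossBinomialSum_zero, div_mul_div_comm] using this
  have h1 := hasSum_crossBinomialSum_mul_of_hasSum (u := A) (v := B) (s := s) h0
    (by simpa using h0) (by simp)
  simpa [crossBinomialSum_zero, hs, mul_comm, mul_left_comm, mul_assoc] using h1

theorem hasSum_crossBinomialSum_mul {u v σ τ : ℂ} (h : ‖u * v * τ * σ‖ < 1) :
    HasSum (fun p : ℕ × ℕ => u ^ p.1 * v ^ p.2
      / ((p.1.factorial : ℂ) * (p.2.factorial : ℂ)) * crossBinomialSum p.1 p.2 τ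
        * crossBinomialSum p.1 p.2 σ)
      ((1 - u * v * τ * σ)⁻¹ * Complex.exp (u + v + τ * u * v
          + (u + τ * u * v) * (v + τ * u * v) * σ / (1 - u * v * τ * σ))) := by
  obtain ⟨s, rfl⟩ := IsAlgClosed.exists_pow_nat_eq σ two_pos
  exact hasSum_crossBinomialSum_mul_of_hasSum (fun A B => hasSum_crossBinomialSum A B τ)
    (fun A B => hasSum_crossBinomialSum A B _) h

/-! ### Circle averages, the diagonal, and the final assembly. -/

theorem integral_exp_sub_angle (j k : ℕ) :
    ∫ φ in (0 : ℝ)..2 * Real.pi, Complex.exp (Complex.I * φ) ^ j * Complex.exp (-(Complex.I * φ)) ^ k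
      = if j = k then (2 * Real.pi : ℂ) else 0 := by
  have e : ∀ φ : ℝ, Complex.exp (Complex.I * φ) ^ j * Complex.exp (-(Complex.I * φ)) ^ k
      = Complex.exp (((j : ℂ) - k) * Complex.I * φ) := by
    intro φ
    rw [← Complex.exp_nat_mul, ← Complex.exp_nat_mul, ← Complex.exp_add]
    congr 1
    ring
  simp_rw [e]
  split_ifs with h
  · subst h
    simp
  · have hjk : ((j : ℂ) - k) ≠ 0 := sub_ne_zero.mpr (by exact_mod_cast h)
    rw [integral_exp_mul_complex (mul_ne_zero hjk Complex.I_ne_zero)]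
    have h1 : Complex.exp (((j : ℂ) - k) * Complex.I * ((2 * Real.pi : ℝ) : ℂ)) = 1 := by
      rw [Complex.exp_eq_one_iff]
      exact ⟨(j : ℤ) - k, by push_cast; ring⟩
    rw [h1]
    simp

/-- The diagonal of an absolutely convergent double series, as a circle average. -/
theorem hasSum_diagonal_circle {a : ℕ × ℕ → ℂ} (ha : Summable a) {G : ℝ → ℂ}
    (hG : ∀ φ : ℝ, HasSum (fun p : ℕ × ℕ => a p
      * (Complex.exp (Complex.I * φ) ^ p.1 * Complex.exp (-(Complex.I * φ)) ^ p.2)) (G φ)) :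
    HasSum (fun j : ℕ => 2 * Real.pi * a (j, j)) (∫ φ in (0 : ℝ)..2 * Real.pi, G φ) := by
  have key := intervalIntegral.hasSum_integral_of_dominated_convergence
    (μ := MeasureTheory.volume) (a := (0 : ℝ)) (b := 2 * Real.pi)
    (F := fun (p : ℕ × ℕ) (φ : ℝ) => a p
      * (Complex.exp (Complex.I * φ) ^ p.1 * Complex.exp (-(Complex.I * φ)) ^ p.2)) (f := G)
    (fun p _ => ‖a p‖) ?_ ?_ ?_ ?_ ?_
  · simp_rw [intervalIntegral.integral_const_mul, integral_exp_sub_angle] at key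
    have hinj : Function.Injective (fun j : ℕ => (j, j)) := fun i j h => (Prod.mk.inj h).1
    rw [← hinj.hasSum_iff] at key
    · simpa [Function.comp_def, mul_comm] using key
    · rintro ⟨j, k⟩ hp
      have : j ≠ k := by rintro rfl; exact hp ⟨j, rfl⟩
      simp [this]
  · intro p
    refine Continuous.aestronglyMeasurable ?_
    fun_prop
  · refine fun p => Filter.Eventually.of_forall fun φ _ => ?_
    rw [norm_mul, norm_mul, norm_pow, norm_pow, mul_comm Complex.I, ← neg_mul,
      Complex.norm_exp_ofReal_mul_I, ← Complex.ofReal_neg, Complex.norm_exp_ofReal_mul_I]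
    simp
  · exact Filter.Eventually.of_forall fun φ _ => ha.norm
  · exact intervalIntegrable_const
  · exact Filter.Eventually.of_forall fun φ _ => hG φ

theorem hasSum_exp_mul_exp (α β : ℂ) : HasSum (fun p : ℕ × ℕ => α ^ p.1 * β ^ p.2
    / ((p.1.factorial : ℂ) * (p.2.factorial : ℂ))) (Complex.exp (α + β)) := by
  simpa [crossBinomialSum_zero] using hasSum_crossBinomialSum α β 0

/-- Rotating u and v in opposite directions preserves uv, so only the linear part of the exponent
varies on the circle. What remains is the circle average of the exponential series in u/b and v/b,
whose diagonal is the Bessel series. -/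
theorem hasSum_crossBinomialSum_diagonal {u v σ τ : ℂ} (h : ‖u * v * τ * σ‖ < 1) :
    HasSum (fun j : ℕ => u ^ j * v ^ j
      / ((j.factorial : ℂ) * (j.factorial : ℂ)) * crossBinomialSum j j τ * crossBinomialSum j j σ)
      ((1 - u * v * τ * σ)⁻¹ * Complex.exp ((τ + σ) * (u * v) / (1 - u * v * τ * σ))
        * ∑' m : ℕ, (u / (1 - u * v * τ * σ)) ^ m * (v / (1 - u * v * τ * σ)) ^ m
          / ((m.factorial : ℂ) * (m.factorial : ℂ))) := by
  set b := 1 - u * v * τ * σ with hb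
  have hb0 : b ≠ 0 := by
    intro h0
    rw [← sub_eq_zero.mp (hb.symm.trans h0)] at h
    simp at h
  have hpi : (2 * Real.pi : ℂ) ≠ 0 := by exact_mod_cast Real.two_pi_pos.ne'
  have h1 := hasSum_diagonal_circle (hasSum_exp_mul_exp (u / b) (v / b)).summable
    (G := fun φ => Complex.exp (u / b * Complex.exp (Complex.I * φ)
      + v / b * Complex.exp (-(Complex.I * φ)))) fun φ => by
      have := hasSum_exp_mul_exp (u / b * Complex.exp (Complex.I * φ))
        (v / b * Complex.exp (-(Complex.I * φ)))
      refine HasSum.congr_fun this fun p => ?_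
      rw [mul_pow, mul_pow]
      ring
  have h2 := hasSum_diagonal_circle (hasSum_crossBinomialSum_mul h).summable
    (G := fun φ => b⁻¹ * Complex.exp ((τ + σ) * (u * v) / b)
      * Complex.exp (u / b * Complex.exp (Complex.I * φ)
      + v / b * Complex.exp (-(Complex.I * φ)))) fun φ => by
      have hE : Complex.exp (Complex.I * φ) * Complex.exp (-(Complex.I * φ)) = 1 := by
        rw [← Complex.exp_add, add_neg_cancel, Complex.exp_zero]
      set E := Complex.exp (Complex.I * φ)
      set E' := Complex.exp (-(Complex.I * φ))
      have huv : (u * E) * (v * E') = u * v := by linear_combination u * v * hE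
      have h3 := hasSum_crossBinomialSum_mul (u := u * E) (v := v * E') (σ := σ) (τ := τ)
        (by rwa [huv])
      rw [mul_assoc τ, huv, ← hb] at h3
      have h4 : u * E + v * E' + τ * (u * v) + (u * E + τ * (u * v)) * (v * E' + τ * (u * v)) * σ / b
          = (τ + σ) * (u * v) / b + (u / b * E + v / b * E') := by
        field_simp
        rw [hb]
        linear_combination (u * v * σ) * hE
      rw [h4, Complex.exp_add, ← mul_assoc] at h3
      refine HasSum.congr_fun h3 fun p => ?_
      rw [mul_pow, mul_pow]
      ring
  rw [intervalIntegral.integral_const_mul, ← h1.tsum_eq, tsum_mul_left, mul_left_comm] at h2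
  exact (hasSum_mul_left_iff hpi).mp h2

theorem hasSum_strict_upper_of_symm {a : ℕ × ℕ → ℂ} {T D : ℂ} (hT : HasSum a T)
    (hD : HasSum (fun j : ℕ => a (j, j)) D) :
    HasSum (fun p : {p : ℕ × ℕ // p.1 < p.2} => a p.1 + a p.1.swap) (T - D) := by
  have hinj : Function.Injective (fun j : ℕ => (j, j)) := fun i j h => (Prod.mk.inj h).1
  set S : Set (ℕ × ℕ) := {p | p.1 < p.2} with hS
  set S' : Set (ℕ × ℕ) := {p | p.2 < p.1} with hS'
  set S₀ : Set (ℕ × ℕ) := {p | p.1 = p.2} with hS₀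
  have h1 := (hT.summable.indicator S).hasSum
  have h2 := (hT.summable.indicator S').hasSum
  have h0 : HasSum (S₀.indicator a) D := by
    rw [← hinj.hasSum_iff]
    · simpa [Function.comp_def, hS₀] using hD
    · rintro ⟨j, k⟩ hp
      have : j ≠ k := by rintro rfl; exact hp ⟨j, rfl⟩
      simp [this, hS₀]
  have hsum : (fun p => S.indicator a p + S'.indicator a p + S₀.indicator a p) = a := by
    ext p
    rcases lt_trichotomy p.1 p.2 with h | h | h
    · simp [hS, hS', hS₀, h, h.le, h.ne]
    · simp [hS, hS', hS₀, h]
    · simp [hS, hS', hS₀, h, h.le, h.ne']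
  have h3 := (h1.add h2).add h0
  rw [hsum] at h3
  rw [hT.unique h3, add_sub_cancel_right]
  have h4 := (Equiv.prodComm ℕ ℕ).hasSum_iff.mpr h2
  refine (hasSum_subtype_iff_indicator (s := S) (f := fun p => a p + a p.swap)).mpr ?_
  refine HasSum.congr_fun (h1.add h4) fun p => ?_
  by_cases h : p.1 < p.2 <;> simp [Set.indicator, hS, hS', h]

theorem hasSum_charlier_strict_upper {x y : ℝ} {u v s : ℂ} (hx : 0 < x) (hy : 0 < y)
    (huv : ‖u * v‖ < x * y) (hs : s ^ 2 = u * v) :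
    HasSum
        (fun p : {p : ℕ × ℕ // p.1 < p.2} =>
          (u ^ p.1.1 * v ^ p.1.2 + u ^ p.1.2 * v ^ p.1.1)
            / ((p.1.1.factorial : ℂ) * (p.1.2.factorial : ℂ))
            * (charlierC p.1.1 (p.1.2 : ℝ) x : ℂ) * (charlierC p.1.1 (p.1.2 : ℝ) y : ℂ))
        ((x * y : ℂ) / (x * y - u * v)
            * Complex.exp (-((x * (u * v) - x * y * (u + v) + y * (u * v)) / (x * y - u * v)))
          - (x * y : ℂ) / (x * y - u * v)
            * Complex.exp (-(u * v * (x + y) / (x * y - u * v)))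
            * besselI 0 (2 * (x * y * s) / (x * y - u * v))) := by
  have hx0 : (x : ℂ) ≠ 0 := by exact_mod_cast hx.ne'
  have hy0 : (y : ℂ) ≠ 0 := by exact_mod_cast hy.ne'
  have hd0 : (x * y - u * v : ℂ) ≠ 0 := by
    intro h
    rw [← sub_eq_zero.mp h, norm_mul, Complex.norm_real, Complex.norm_real,
      Real.norm_of_nonneg hx.le, Real.norm_of_nonneg hy.le] at huv
    exact lt_irrefl _ huv
  have hq : ‖u * v * (-1 / x) * (-1 / y)‖ < 1 := by
    have e : u * v * (-1 / x) * (-1 / y) = (u * v) / ((x * y : ℝ) : ℂ) := by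
      push_cast
      field_simp
    rw [e, norm_div, Complex.norm_real, Real.norm_of_nonneg (by positivity),
      div_lt_one (by positivity)]
    exact huv
  have hb : (1 - u * v * (-1 / x) * (-1 / y) : ℂ) = (x * y - u * v) / (x * y) := by
    field_simp
  have h := hasSum_strict_upper_of_symm (hasSum_crossBinomialSum_mul hq)
    (hasSum_crossBinomialSum_diagonal hq)
  have hbessel : ∑' m : ℕ, (u / ((x * y - u * v) / (x * y))) ^ m
        * (v / ((x * y - u * v) / (x * y))) ^ m / ((m.factorial : ℂ) * (m.factorial : ℂ))
      = besselI 0 (2 * (x * y * s) / (x * y - u * v)) := by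
    unfold besselI
    -- Only even powers of s occur, so either square root of uv gives the same terms.
    refine tsum_congr fun m => ?_
    rw [add_zero, add_zero, pow_mul, ← mul_pow]
    congr 2
    field_simp
    rw [hs]
  rw [hb, hbessel] at h
  have e1 : u + v + -1 / x * u * v + (u + -1 / x * u * v) * (v + -1 / x * u * v) * (-1 / y)
        / ((x * y - u * v) / (x * y))
      = -((x * (u * v) - x * y * (u + v) + y * (u * v)) / (x * y - u * v)) := by
    field_simp
    ring
  have e2 : (-1 / x + -1 / y) * (u * v) / ((x * y - u * v) / (x * y))
      = -(u * v * (x + y) / (x * y - u * v)) := by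
    field_simp
    ring
  rw [e1, e2, inv_div] at h
  refine HasSum.congr_fun h fun p => ?_
  -- Symmetry in (j, k) lets the terms at (j, k) and (k, j) share their Charlier factors.
  rw [charlierC_natCast, charlierC_natCast, ofReal_crossBinomialSum, ofReal_crossBinomialSum,
    Prod.fst_swap, Prod.snd_swap, crossBinomialSum_comm p.1.2, crossBinomialSum_comm p.1.2]
  push_cast
  ring

theorem corollary1p4 :
    (∀ (N : ℕ) (H : Matrix (Fin N) (Fin N) ℂ) (ρ θ : Fin N → ℝ) (W : Fin N → ℂ),
      H.IsHermitian → frobNorm H < 1 → (∀ m, 0 < ρ m) →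
      (∀ m, W m = (ρ m : ℂ) * Complex.exp (Complex.I * (θ m : ℂ))) →
      HasSum
        (fun K : Matrix (Fin N) (Fin N) ℕ =>
          ∏ m : Fin N,
            ((∏ n : Fin N, (-H m n) ^ K m n)
              * (Nat.multinomial Finset.univ (fun j => K j m) : ℂ)
              * ((ρ m : ℂ) * Complex.exp (-(Complex.I * (θ m : ℂ))))
                  ^ ((rowSum K m : ℤ) - (colSum K m : ℤ))
              * ((laguerreL (colSum K m) ((rowSum K m : ℝ) - (colSum K m : ℝ))
                  (ρ m ^ 2) : ℝ) : ℂ)))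
        ((1 + H).det⁻¹ * Complex.exp (star W ⬝ᵥ ((H * (1 + H)⁻¹) *ᵥ W))))
    ∧
    (∀ (x y : ℝ) (u v s : ℂ), 0 < x → 0 < y → ‖u * v‖ < x * y → s ^ 2 = u * v →
      HasSum
        (fun p : {p : ℕ × ℕ // p.1 < p.2} =>
          (u ^ p.1.1 * v ^ p.1.2 + u ^ p.1.2 * v ^ p.1.1)
            / ((p.1.1.factorial : ℂ) * (p.1.2.factorial : ℂ))
            * (charlierC p.1.1 (p.1.2 : ℝ) x : ℂ) * (charlierC p.1.1 (p.1.2 : ℝ) y : ℂ))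
        ((x * y : ℂ) / (x * y - u * v)
            * Complex.exp (-((x * (u * v) - x * y * (u + v) + y * (u * v)) / (x * y - u * v)))
          - (x * y : ℂ) / (x * y - u * v)
            * Complex.exp (-(u * v * (x + y) / (x * y - u * v)))
            * besselI 0 (2 * (x * y * s) / (x * y - u * v)))) := by
  refine ⟨fun N H ρ θ W hH hF hρ hW => ?_,
    fun x y u v s hx hy huv hs => hasSum_charlier_strict_upper hx hy huv hs⟩
  have hconj : ∀ m, (starRingEnd ℂ) (W m) = (ρ m : ℂ) * Complex.exp (-(Complex.I * (θ m : ℂ))) := by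
    intro m
    rw [hW, map_mul, Complex.conj_ofReal, ← Complex.exp_conj, map_mul, Complex.conj_I,
      Complex.conj_ofReal, neg_mul]
  have hnorm : ∀ m, ‖W m‖ = ρ m := by
    intro m
    rw [hW, norm_mul, mul_comm Complex.I, Complex.norm_exp_ofReal_mul_I, mul_one,
      Complex.norm_real, Real.norm_of_nonneg (hρ m).le]
  have h := hasSum_laguerre_matrix hH hF W fun m => by
    rw [← norm_ne_zero_iff, hnorm]
    exact (hρ m).ne'
  simp_rw [hconj, hnorm] at h
  exact h
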